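/- **Setting.** Let $0\le\epsilon<1/6$ and let $fl:\mathbb R\to\mathbb R$ satisfy $|fl(x)-x|\le\epsilon|x|$ for all $x$; every primitive operation $x\circ y$, $\circ\in\{-,\cdot\}$, is computed as $fl(x\circ y)$. Put $\gamma_6=\frac{6\epsilon}{1-6\epsilon}$. For points of $\mathbb R^2$ let $\widehat{rt}(p,u,q)$ be the floating-point evaluation of $(p_x-u_x)(q_y-p_y)>(p_y-u_y)(q_x-p_x)$ ("$u$ is to the left of $pq$") and $\widehat{frt}(p,q,u,u')$ that of $(q_y-p_y)(u_x-u'_x)<(q_x-p_x)(u_y-u'_y)$ ("$u$ is farther from $pq$ than $u'$"). *Reduction.* $\mathrm{reduce}_{p,q}(L)$ is the point selected from a nonempty finite list $L$ by comparisons with $\widehat{frt}(p,q,\cdot,\cdot)$ in one of three evaluation orders: a sequential pass, blocks of length $m\ge1$ (the winner of each block is compared with the running candidate), or recursive halving (pairwise). Correspondingly let $c(n)=n-1$, $c(n)=m+n/m$, $c(n)=\lceil\log_2 n\rceil$. A function $F:\mathbb N\to\mathbb R$, $n\mapsto F_n$, is a *reduction bound* if $\bigl(d(r,pq)-d(\hat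 r,pq)\bigr)/M'\le F_n$ for all $p\ne q$, every list $L$ of $n\ge1$ points strictly to the left of $pq$, every $r\in L$ and $\hat r=\mathrm{reduce}_{p,q}(L)$, where $d(\cdot,pq)$ is the distance to the line through $p,q$ and $M'$ is the maximal absolute value of the coordinates of $p,q$ and the points of $L$. *Algorithm.* HULL$(L,p,r,q)$ returns $L$ if $|L|\le1$. Otherwise, with $S_1=\{u\in L:\widehat{rt}(p,u,r)\}$, $S_2=\{u\in L:\widehat{rt}(r,u,q)\}$, $r_1=\mathrm{reduce}_{p,r}(S_1)$, $r_2=\mathrm{reduce}_{r,q}(S_2)$, it returns $\{p\}\cup$HULL$(S_1,p,r_1,r)\cup\{r\}\cup$HULL$(S_2,r,r_2,q)\cup\{q\}$. Its depth is $0$ in the first case and one more than the maximal depth of the two inner calls in the second. Quickhull on a nonempty finite list $P$ takes a left-most point $p$ and a right-most point $q$ of $P$ (ties arbitrary, but $p$ lowest and $q$ highest if all points lie on one vertical line), puts $S_1=\{u\in P:\widehat{rt}(p,u,q)\}$, $S_2=\{u\in P:\widehat{rt}(q,u,p)\}$, and returns $\hat H=\{p\}\cup$HULL$(S_1,p,\mathrm{reduce}_{p,q}(S_1),q)\cup\{q\}\cup$HULL$(S_2,q,\mathrm{reduce}_{q,p}(S_2),p)$;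 its depth $D$ is one more than the maximal depth of these two calls. *Forward error.* For a computed hull $\hat H$ of $P$ it is $d_M(CH(\hat H),CH(P))=d(CH(\hat H),CH(P))/M$, where $CH$ is the convex hull, $d$ the Hausdorff distance, and $M$ the maximal absolute value of the coordinates of the points of $P$ (for $M=0$ both hulls are $\{0\}$ and the error is $0$). **Theorem.** For each of the three evaluation orders: 1. $F_n=2\gamma_6\,c(n)$ is a reduction bound. 2. If a run of Quickhull on $P$ terminates with depth $D$, its forward error is at most $2DF_{|P|}$ for every reduction bound $F$ with $F_{|P|}\ge\gamma_6$ (this inequality is required only if $|P|\ge2$); it is also at most $2DF_{|P|}$ for $F_n=\gamma_6\,c(n)$. 3. The same holds for HULL: if all $u\in L$ satisfy $\widehat{rt}(p,u,q)$ and have $x$-coordinates between those of $p$ and $q$, and HULL$(L,p,\mathrm{reduce}_{p,q}(L),q)$ terminates with output $\hat H$ and depth $D$, then the forward error of $\hat H\cup\{p,q\}$ as the hull of $L\cup\{p,q\}$ is at most $2DF_{|L|}$, for the same choices of $F$ (with $|L|$ in place of $|P|$). 4. If $fl(-x)=-fl(x)$ for all $x$, then on every nonempty $P$ Quickhull has a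 terminating run, and every terminating run has $D\le|P|$. Consequently there is an absolute constant $C>0$ such that for $\epsilon\le1/12$ the forward error of every terminating run is at most $C\,D|P|\epsilon$, and at most $C\,|P|^2\epsilon$ if $fl(-x)=-fl(x)$ for all $x$, with sequential reduction; at most $C\,D\,(m+|P|/m)\,\epsilon$ with blocked reduction; and at most $C\,D\log|P|\,\epsilon$ with pairwise reduction. -/

import Mathlib

namespace FloatQuickhull

/-- Points of the plane; `u 0` and `u 1` are the `x`- and `y`-coordinate. -/
abbrev Pt := EuclideanSpace ℝ (Fin 2)

/-- The standard model of floating-point arithmetic with machine precision `ε`: the computed value of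
a primitive operation is `fl` of its exact value, with relative error at most `ε`. -/
def IsRounding (fl : ℝ → ℝ) (ε : ℝ) : Prop :=
  ∀ x : ℝ, |fl x - x| ≤ ε * |x|

/-- `γ₆ = 6ε / (1 - 6ε)`. -/
noncomputable def gamma6 (ε : ℝ) : ℝ := 6 * ε / (1 - 6 * ε)

/-- The orientation of `p, u, q`; positive iff `u` lies to the left of the oriented line `pq`. -/
def orient (p u q : Pt) : ℝ :=
  (p 0 - u 0) * (q 1 - u 1) - (p 1 - u 1) * (q 0 - u 0)

/-- The distance from `u` to the line through `p` and `q`. -/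
noncomputable def lineDist (u p q : Pt) : ℝ :=
  Metric.infDist u (line[ℝ, p, q] : Set Pt)

/-- The computed right-turn test,
`(p_x - u_x) (q_y - p_y) > (p_y - u_y) (q_x - p_x)` in floating point. -/
def rtHat (fl : ℝ → ℝ) (p u q : Pt) : Prop :=
  fl (fl (p 0 - u 0) * fl (q 1 - p 1)) > fl (fl (p 1 - u 1) * fl (q 0 - p 0))

/-- The computed test "`u` is farther from `pq` than `u'`",
`(q_y - p_y) (u_x - u'_x) < (q_x - p_x) (u_y - u'_y)` in floating point. -/
def frtHat (fl : ℝ → ℝ) (p q u u' : Pt) : Prop :=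
  fl (fl (q 1 - p 1) * fl (u 0 - u' 0)) < fl (fl (q 0 - p 0) * fl (u 1 - u' 1))

/-- The evaluation orders of the farthest-point reduction: one sequential pass, blocks of length `m`,
or recursive halving. -/
inductive Scheme where
  | simple : Scheme
  | blocked (m : ℕ+) : Scheme
  | pairwise : Scheme

/-- Sequential reduction, starting with the candidate `a`. -/
noncomputable def simpleReduce (far : Pt → Pt → Prop) (a : Pt) (L : List Pt) : Pt :=
  open Classical in L.foldl (fun uMax u => if far u uMax then u else uMax) a

/-- Sequential reduction of one block (the value `d` for an empty block is never used). -/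
noncomputable def blockReduce (far : Pt → Pt → Prop) (d : Pt) : List Pt → Pt
  | [] => d
  | a :: L => simpleReduce far a L

/-- Blocked reduction: the winner of every block of length `m` is compared with the candidate. -/
noncomputable def blockedReduce (far : Pt → Pt → Prop) (m : ℕ) (a : Pt) (L : List Pt) : Pt :=
  simpleReduce far a ((L.toChunks m).map (blockReduce far a))

/-- Reduction by recursive halving (the value `d` for an empty list is never used). -/
noncomputable def pairwiseReduce (far : Pt → Pt → Prop) (d : Pt) : List Pt → Pt
  | [] => d
  | [a] => a
  | a :: b :: L =>
    let u₁ := pairwiseReduce far d ((a :: b :: L).take ((a :: b :: L).length / 2))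
    let u₂ := pairwiseReduce far d ((a :: b :: L).drop ((a :: b :: L).length / 2))
    open Classical in if far u₁ u₂ then u₁ else u₂
termination_by L => L.length
decreasing_by all_goals (simp only [List.length_take, List.length_drop, List.length_cons]; omega)

/-- The computed farthest point from `pq` in a nonempty list. For the empty list a dummy value is
returned, which the algorithm never looks at. -/
noncomputable def farthest (fl : ℝ → ℝ) (s : Scheme) (p q : Pt) : List Pt → Pt
  | [] => p
  | a :: L =>
    match s with
    | .simple => simpleReduce (frtHat fl p q) a L
    | .blocked m => blockedReduce (frtHat fl p q) m a L
    | .pairwise => pairwiseReduce (frtHat fl p q) a (a :: L)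

/-- The points of `L` that are computed to be to the left of `pq`. -/
noncomputable def leftOf (fl : ℝ → ℝ) (p q : Pt) (L : List Pt) : List Pt :=
  open Classical in L.filter (fun u => decide (rtHat fl p u q))

/-- `HullRun fl s L p r q H D`: the floating-point call `HULL(L, p, r, q)` terminates with output `H`
and recursion depth `D` (a call that makes no recursive call has depth `0`). -/
inductive HullRun (fl : ℝ → ℝ) (s : Scheme) :
    List Pt → Pt → Pt → Pt → List Pt → ℕ → Prop
  | base (L : List Pt) (p r q : Pt) : L.length ≤ 1 → HullRun fl s L p r q L 0
  | step (L : List Pt) (p r q : Pt) (H₁ H₂ : List Pt) (D₁ D₂ : ℕ) : 1 < L.length →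
      HullRun fl s (leftOf fl p r L) p (farthest fl s p r (leftOf fl p r L)) r H₁ D₁ →
      HullRun fl s (leftOf fl r q L) r (farthest fl s r q (leftOf fl r q L)) q H₂ D₂ →
      HullRun fl s L p r q ([p] ++ H₁ ++ [r] ++ H₂ ++ [q]) (max D₁ D₂ + 1)

/-- `p` is a left-most and `q` a right-most point of `P`. Ties are broken arbitrarily, except that for
points on one vertical line `p` is the lowest and `q` the highest. -/
def IsExtremePair (P : List Pt) (p q : Pt) : Prop :=
  p ∈ P ∧ q ∈ P ∧ (∀ u ∈ P, p 0 ≤ u 0 ∧ u 0 ≤ q 0) ∧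
    (p 0 = q 0 → ∀ u ∈ P, p 1 ≤ u 1 ∧ u 1 ≤ q 1)

/-- Floating-point Quickhull on `P` terminates with output `H` and recursion depth `D`; its first step
has the structure of a call of `HULL` and counts as one level. -/
def QuickhullRun (fl : ℝ → ℝ) (s : Scheme) (P H : List Pt) (D : ℕ) : Prop :=
  ∃ (p q : Pt) (H₁ H₂ : List Pt) (D₁ D₂ : ℕ), IsExtremePair P p q ∧
    HullRun fl s (leftOf fl p q P) p (farthest fl s p q (leftOf fl p q P)) q H₁ D₁ ∧
    HullRun fl s (leftOf fl q p P) q (farthest fl s q p (leftOf fl q p P)) p H₂ D₂ ∧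
    H = [p] ++ H₁ ++ [q] ++ H₂ ∧ D = max D₁ D₂ + 1

/-- `M`: the maximum absolute value of the coordinates of the points of `P`. -/
noncomputable def maxCoord (P : List Pt) : ℝ :=
  (P.map fun u => max |u 0| |u 1|).foldr max 0

/-- The convex hull of a finite list of points. -/
def CH (P : List Pt) : Set Pt := convexHull ℝ {u | u ∈ P}

/-- The forward error `d_M(CH(H), CH(P)) = d(CH(H), CH(P)) / M` of the computed hull `H` of `P`, where
`d` is the Hausdorff distance and `M` belongs to the input `P`. -/
noncomputable def forwardError (H P : List Pt) : ℝ :=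
  Metric.hausdorffDist (CH H) (CH P) / maxCoord P

/-- `F n` bounds the scaled error `(d(r, pq) - d(r̂, pq)) / M` of the computed farthest point `r̂` among
`n` points to the left of `pq`. -/
def IsReductionBound (fl : ℝ → ℝ) (s : Scheme) (F : ℕ → ℝ) : Prop :=
  ∀ (L : List Pt) (p q : Pt), L ≠ [] → p ≠ q → (∀ u ∈ L, 0 < orient p u q) →
    ∀ r ∈ L, (lineDist r p q - lineDist (farthest fl s p q L) p q) / maxCoord (p :: q :: L) ≤
      F L.length

/-- The number of comparisons through which an error can propagate in a reduction of `n` points: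
`n - 1`, `m + n / m` and `⌈log₂ n⌉` for the three evaluation orders. -/
noncomputable def chain : Scheme → ℕ → ℝ
  | .simple, n => ((n - 1 : ℕ) : ℝ)
  | .blocked m, n => (m : ℝ) + (n : ℝ) / (m : ℝ)
  | .pairwise, n => (Nat.clog 2 n : ℝ)

end FloatQuickhull

namespace FloatQuickhull

/-! ### Rounding of a product of rounded factors -/

/-! The forward error is in fact at most `2γ₆`, whatever the depth and however well the farthest
points are chosen; the reduction matters only in that it returns a point of its list.

Both sides of each test are products of two rounded factors, rounded again. If the computed
comparison favours the wrong side, the exact products differ by at most `γ₆` times the smaller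
absolute value (`IsRounding.sub_le_of_le`). For the orientation test one product is `(p 1 - u 1) *
(q 0 - p 0)`, and the orientation itself is `q 0 - p 0` times the vertical distance from `u` to
`pq`. The factor `q 0 - p 0` cancels, so a wrong decision about a point in the strip over `pq` means
a vertical distance of at most `2γ₆M`, however short the edge.

Follow one input point down the recursion, always into a call whose strip contains it. Passing a
test puts it on the outer side of the current edge up to `2γ₆M`; failing the next test puts it on
the inner side of the new edge up to `2γ₆M`. At the first failure it is enclosed vertically by two
segments of the computed hull, up to that error, and convexity gives a hull point this close
(`HullRun.exists_dist_le`). Only the last two tests count, so nothing accumulates. Convexity carries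
the bound from the points to their hull.

The stated bounds follow from `D ≥ 1` and `F ≥ γ₆`; the exceptional cases, depth `0` or a single
input point, have error `0`. The reduction bound is separate: each comparison loses at most `2γ₆M`
in distance, and `chain` bounds the number of losses along the path from the true farthest point to
the winner. -/

theorem IsRounding.map_zero {fl : ℝ → ℝ} {ε : ℝ} (h : IsRounding fl ε) : fl 0 = 0 := by
  simpa using h 0

theorem IsRounding.exists_eq_mul {fl : ℝ → ℝ} {ε : ℝ} (h : IsRounding fl ε) (hε : 0 ≤ ε) (x : ℝ) :
    ∃ κ, 1 - ε ≤ κ ∧ κ ≤ 1 + ε ∧ fl x = κ * x := by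
  rcases eq_or_ne x 0 with rfl | hx
  · exact ⟨1, by linarith, by linarith, by simp [h.map_zero]⟩
  · have h1 : |fl x / x - 1| ≤ ε := by
      have : fl x / x - 1 = (fl x - x) / x := by field_simp
      rw [this, abs_div, div_le_iff₀ (abs_pos.2 hx)]
      exact h x
    have := abs_le.1 h1
    exact ⟨fl x / x, by linarith, by linarith, by field_simp⟩

theorem IsRounding.exists_mul_eq {fl : ℝ → ℝ} {ε : ℝ} (h : IsRounding fl ε) (hε : 0 ≤ ε)
    (hε' : 6 * ε < 1) (x y : ℝ) :
    ∃ κ, (1 - ε) ^ 3 ≤ κ ∧ κ ≤ (1 + ε) ^ 3 ∧ fl (fl x * fl y) = κ * (x * y) := by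
  obtain ⟨a, ha, ha', hxa⟩ := h.exists_eq_mul hε x
  obtain ⟨b, hb, hb', hyb⟩ := h.exists_eq_mul hε y
  obtain ⟨c, hc, hc', hzc⟩ := h.exists_eq_mul hε (fl x * fl y)
  have h0 : 0 ≤ 1 - ε := by linarith
  have hca : 0 ≤ c * a := mul_nonneg (by linarith) (by linarith)
  refine ⟨c * a * b, ?_, ?_, by rw [hzc, hxa, hyb]; ring⟩
  · calc (1 - ε) ^ 3 = (1 - ε) * (1 - ε) * (1 - ε) := by ring
      _ ≤ c * a * b := by gcongr; linarith
  · calc c * a * b ≤ (1 + ε) * (1 + ε) * (1 + ε) := by gcongr <;> linarith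
      _ = (1 + ε) ^ 3 := by ring

theorem gamma6_nonneg {ε : ℝ} (hε : 0 ≤ ε) (hε' : 6 * ε < 1) : 0 ≤ gamma6 ε :=
  div_nonneg (by linarith) (by linarith)

/-- Three roundings on either side can distort the ratio of two products by `((1 + ε) / (1 - ε)) ^
3`. Bernoulli gives `1 - 6ε ≤ (1 - ε) ^ 6`, and `(1 + ε) (1 - ε) ≤ 1` absorbs the rest. -/
theorem one_add_pow_le_gamma6 {ε : ℝ} (hε : 0 ≤ ε) (hε' : 6 * ε < 1) :
    (1 + ε) ^ 3 ≤ (1 + gamma6 ε) * (1 - ε) ^ 3 := by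
  have h1 : 0 < 1 - 6 * ε := by linarith
  have h2 : 1 + gamma6 ε = 1 / (1 - 6 * ε) := by
    unfold gamma6
    field_simp
    ring
  have hb : 1 - 6 * ε ≤ (1 - ε) ^ 6 := by
    have := one_add_mul_le_pow (a := -ε) (by linarith) 6
    calc 1 - 6 * ε = 1 + ((6 : ℕ) : ℝ) * (-ε) := by push_cast; ring
      _ ≤ (1 + -ε) ^ 6 := this
      _ = (1 - ε) ^ 6 := by ring
  have hc : (1 - ε ^ 2) ^ 3 ≤ 1 := pow_le_one₀ (by nlinarith) (by nlinarith)
  rw [h2, div_mul_eq_mul_div, le_div_iff₀ h1, one_mul]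
  have h0 : 0 ≤ 1 - ε := by linarith
  calc (1 + ε) ^ 3 * (1 - 6 * ε) ≤ (1 + ε) ^ 3 * (1 - ε) ^ 6 := by gcongr
    _ = (1 - ε ^ 2) ^ 3 * (1 - ε) ^ 3 := by ring
    _ ≤ 1 * (1 - ε) ^ 3 := by gcongr
    _ = (1 - ε) ^ 3 := one_mul _

/-- A comparison of two computed products can be wrong only up to the relative error `γ₆`. -/
theorem IsRounding.sub_le_of_le {fl : ℝ → ℝ} {ε : ℝ} (h : IsRounding fl ε) (hε : 0 ≤ ε)
    (hε' : 6 * ε < 1) {x y x' y' : ℝ} (hle : fl (fl x * fl y) ≤ fl (fl x' * fl y')) :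
    x * y - x' * y' ≤ gamma6 ε * min |x * y| |x' * y'| := by
  obtain ⟨κ, h1, h2, e⟩ := h.exists_mul_eq hε hε' x y
  obtain ⟨κ', h1', h2', e'⟩ := h.exists_mul_eq hε hε' x' y'
  rw [e, e'] at hle
  have hγ := gamma6_nonneg hε hε'
  have hγ' := one_add_pow_le_gamma6 hε hε'
  have hl : 0 < (1 - ε) ^ 3 := pow_pos (by linarith) 3
  generalize x * y = a at *
  generalize x' * y' = b at *
  generalize gamma6 ε = γ at *
  generalize (1 - ε) ^ 3 = l at *
  generalize (1 + ε) ^ 3 = u at *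
  rcases le_or_gt a b with hab | hab
  · have : 0 ≤ γ * min |a| |b| := by positivity
    linarith
  rcases le_or_gt 0 b with hb | hb
  · have ha : 0 ≤ a := by linarith
    rw [abs_of_nonneg ha, abs_of_nonneg hb, min_eq_right hab.le]
    have : a * l ≤ (1 + γ) * b * l := by nlinarith
    have := le_of_mul_le_mul_right this hl
    linarith
  -- Rounding preserves signs, so a nonnegative `a` could not be computed as at most a negative `b`.
  -- The negative case then mirrors the positive one with the roles of `a` and `b` exchanged.
  · have ha : a < 0 := by
      by_contra! ha
      nlinarith [mul_nonneg (hl.le.trans h1) ha, mul_pos (hl.trans_le h1') (neg_pos.2 hb)]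
    rw [abs_of_neg ha, abs_of_neg hb, min_eq_left (by linarith)]
    have : (-b) * l ≤ (1 + γ) * (-a) * l := by nlinarith
    have := le_of_mul_le_mul_right this hl
    linarith

/-! ### Reduction by approximate comparisons -/

/-- On `A`, the comparison `far` decides which of two values of `f` is larger up to the error `e`. -/
def ComparesUpTo (far : Pt → Pt → Prop) (f : Pt → ℝ) (e : ℝ) (A : Set Pt) : Prop :=
  ∀ u ∈ A, ∀ v ∈ A, (far u v → f v ≤ f u + e) ∧ (¬ far u v → f u ≤ f v + e)

theorem simpleReduce_mem (far : Pt → Pt → Prop) (a : Pt) (L : List Pt) :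
    simpleReduce far a L ∈ a :: L := by
  induction L generalizing a with
  | nil => simp [simpleReduce]
  | cons b L ih =>
    have h := ih (open Classical in if far b a then b else a)
    change simpleReduce far (open Classical in if far b a then b else a) L ∈ _
    split_ifs at h ⊢ <;> simp only [List.mem_cons] at h ⊢ <;> tauto

/-- Every comparison lowers the running candidate's value by at most `e`, and there is one
comparison per element of the tail. -/
theorem simpleReduce_bound {far : Pt → Pt → Prop} {f : Pt → ℝ} {e : ℝ} {A : Set Pt} (he : 0 ≤ e)
    (hc : ComparesUpTo far f e A) (a : Pt) (L : List Pt) (hA : ∀ u ∈ a :: L, u ∈ A) :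
    ∀ r ∈ a :: L, f r ≤ f (simpleReduce far a L) + e * L.length := by
  induction L generalizing a with
  | nil => simp [simpleReduce]
  | cons b L ih =>
    intro r hr
    have ha := hA a (by simp)
    have hb := hA b (by simp)
    have hL : ∀ u ∈ L, u ∈ A := fun u hu => hA u (by simp [hu])
    change f r ≤ f (simpleReduce far (open Classical in if far b a then b else a) L) + _
    push_cast [List.length_cons]
    have hcc := hc b hb a ha
    split_ifs with hf
    · have key := ih b (by simpa using ⟨hb, hL⟩)
      have := hcc.1 hf
      have hkb := key b (by simp)
      rcases (by simpa using hr : r = a ∨ r = b ∨ r ∈ L) with rfl | rfl | h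
      · linarith
      · linarith
      · linarith [key r (by simp [h])]
    · have key := ih a (by simpa using ⟨ha, hL⟩)
      have := hcc.2 hf
      have hka := key a (by simp)
      rcases (by simpa using hr : r = a ∨ r = b ∨ r ∈ L) with rfl | rfl | h
      · linarith
      · linarith
      · linarith [key r (by simp [h])]

/-! ### Splitting a list into blocks, and blocked reduction -/

/-- Loop invariant: `acc₁` is the block being filled, never empty, and `acc₂` holds the finished
blocks. The length estimate says that only the last block may be incomplete. -/
theorem toChunks_go_spec {α : Type*} {n : ℕ} (xs : List α) (acc₁ : Array α)
    (acc₂ : Array (List α)) (h₁ : 0 < acc₁.size) (h₁' : acc₁.size ≤ n)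
    (h₂ : ∀ c ∈ acc₂.toList, c ≠ [] ∧ c.length ≤ n) :
    (List.toChunks.go n xs acc₁ acc₂).flatten = acc₂.toList.flatten ++ acc₁.toList ++ xs ∧
    (∀ c ∈ List.toChunks.go n xs acc₁ acc₂, c ≠ [] ∧ c.length ≤ n) ∧
    (List.toChunks.go n xs acc₁ acc₂).length * n < acc₂.size * n + acc₁.size + xs.length + n := by
  have hne : acc₁.toList ≠ [] := by
    intro h
    have := congrArg List.length h
    simp at this
    simp [this] at h₁
  have hpush : ∀ c ∈ (acc₂.push acc₁.toList).toList, c ≠ [] ∧ c.length ≤ n := by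
    intro c hc
    rcases (by simpa using hc : c ∈ acc₂ ∨ c = acc₁.toList) with hc | rfl
    · exact h₂ c (by simpa using hc)
    · exact ⟨hne, by simpa using h₁'⟩
  induction xs generalizing acc₁ acc₂ with
  | nil =>
    simp only [List.toChunks.go]
    refine ⟨by simp, hpush, ?_⟩
    simp only [Array.length_toList, Array.size_push, List.length_nil]
    lia
  | cons x xs ih =>
    simp only [List.toChunks.go, beq_iff_eq]
    split_ifs with hs
    · have hp2 : ∀ c ∈ ((acc₂.push acc₁.toList).push #[x].toList).toList,
          c ≠ [] ∧ c.length ≤ n := by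
        intro c hc
        rcases (by simpa [or_assoc] using hc : (c ∈ acc₂ ∨ c = acc₁.toList) ∨ c = [x]) with hc | rfl
        · exact hpush c (by simpa using hc)
        · exact ⟨by simp, by simp; omega⟩
      obtain ⟨a, b, c⟩ := ih #[x] (acc₂.push acc₁.toList) (by simp)
        (by simp; omega) hpush (by simp) hp2
      refine ⟨?_, b, ?_⟩
      · refine a.trans ?_
        simp
      · refine c.trans_eq ?_
        simp only [Array.size_push, hs, List.length_cons, List.size_toArray, List.length_nil]
        ring
    · have hp2 : ∀ c ∈ (acc₂.push (acc₁.push x).toList).toList, c ≠ [] ∧ c.length ≤ n := by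
        intro c hc
        rcases (by simpa using hc : c ∈ acc₂ ∨ c = acc₁.toList ++ [x]) with hc | rfl
        · exact h₂ c (by simpa using hc)
        · exact ⟨by simp, by simp; omega⟩
      obtain ⟨a, b, c⟩ := ih (acc₁.push x) acc₂ (by simp) (by simp; omega) h₂
        (by simp) hp2
      refine ⟨by rw [a]; simp, b, c.trans_eq ?_⟩
      simp only [Array.size_push, List.length_cons]
      ring

theorem toChunks_spec {α : Type*} {n : ℕ} (hn : 0 < n) (xs : List α) :
    (xs.toChunks n).flatten = xs ∧ (∀ c ∈ xs.toChunks n, c ≠ [] ∧ c.length ≤ n) ∧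
    (xs.toChunks n).length * n < xs.length + n := by
  cases xs with
  | nil => simpa [List.toChunks] using hn
  | cons x xs =>
    obtain ⟨k, rfl⟩ := Nat.exists_eq_succ_of_ne_zero hn.ne'
    obtain ⟨a, b, c⟩ := toChunks_go_spec xs #[x] #[] (n := k + 1) (by simp) (by simp) (by simp)
    simp only [List.toChunks]
    refine ⟨by rw [a]; simp, b, c.trans_eq ?_⟩
    simp only [List.length_cons, List.size_toArray, List.length_nil]
    lia

theorem blockReduce_mem (far : Pt → Pt → Prop) (d : Pt) {c : List Pt} (hc : c ≠ []) :
    blockReduce far d c ∈ c := by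
  cases c with
  | nil => exact absurd rfl hc
  | cons a c => exact simpleReduce_mem far a c

theorem blockedReduce_winner_mem (far : Pt → Pt → Prop) {m : ℕ} (hm : 0 < m) (a : Pt)
    (L : List Pt) : ∀ u ∈ (L.toChunks m).map (blockReduce far a), u ∈ L := by
  obtain ⟨hflat, hne, -⟩ := toChunks_spec hm L
  intro u hu
  obtain ⟨c, hc, rfl⟩ := List.mem_map.1 hu
  rw [← hflat]
  exact List.mem_flatten.2 ⟨c, hc, blockReduce_mem far a (hne c hc).1⟩

theorem blockedReduce_mem (far : Pt → Pt → Prop) {m : ℕ} (hm : 0 < m) (a : Pt) (L : List Pt) :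
    blockedReduce far m a L ∈ a :: L := by
  rcases List.mem_cons.1 (simpleReduce_mem far a ((L.toChunks m).map (blockReduce far a)))
    with h | h
  · exact List.mem_cons.2 (.inl h)
  · exact List.mem_cons.2 (.inr (blockedReduce_winner_mem far hm a L _ h))

/-- At most `m - 1` losses inside a block and at most `1 + n / m` among the block winners; the two
units cancel. -/
theorem blockedReduce_bound {far : Pt → Pt → Prop} {f : Pt → ℝ} {e : ℝ} {A : Set Pt} (he : 0 ≤ e)
    (hc : ComparesUpTo far f e A) {m : ℕ} (hm : 0 < m) (a : Pt) (L : List Pt)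
    (hA : ∀ u ∈ a :: L, u ∈ A) :
    ∀ r ∈ a :: L, f r ≤ f (blockedReduce far m a L) +
      e * ((m : ℝ) + ((a :: L).length : ℝ) / (m : ℝ)) := by
  obtain ⟨hflat, hne, hlen⟩ := toChunks_spec hm L
  have hw := blockedReduce_winner_mem far hm a L
  have hm' : (0 : ℝ) < m := by exact_mod_cast hm
  have houter := simpleReduce_bound he hc a ((L.toChunks m).map (blockReduce far a)) (by
    intro u hu
    rcases List.mem_cons.1 hu with rfl | hu
    · exact hA _ (by simp)
    · exact hA u (by simp [hw u hu]))
  have hk : (((L.toChunks m).map (blockReduce far a)).length : ℝ) ≤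
      1 + ((a :: L).length : ℝ) / m := by
    rw [← sub_le_iff_le_add', le_div_iff₀ hm', sub_mul, one_mul, List.length_map]
    have : ((L.toChunks m).length : ℝ) * m < L.length + m := by exact_mod_cast hlen
    push_cast [List.length_cons]
    linarith
  have hek := mul_le_mul_of_nonneg_left hk he
  have hm1 : (1 : ℝ) ≤ m := by exact_mod_cast hm
  change ∀ r ∈ a :: L, f r ≤ f (simpleReduce far a _) + _
  intro r hr
  rcases List.mem_cons.1 hr with rfl | hr
  · have := houter r (by simp)
    nlinarith
  · rw [← hflat] at hr
    obtain ⟨c, hcm, hrc⟩ := List.mem_flatten.1 hr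
    have h1 := houter (blockReduce far a c)
      (List.mem_cons.2 (.inr (List.mem_map.2 ⟨c, hcm, rfl⟩)))
    have h2 : f r ≤ f (blockReduce far a c) + e * (m - 1) := by
      have hcA : ∀ u ∈ c, u ∈ A := fun u hu =>
        hA u (List.mem_cons.2 (.inr (hflat ▸ List.mem_flatten.2 ⟨c, hcm, hu⟩)))
      have hcl := (hne c hcm).2
      cases c with
      | nil => simp at hrc
      | cons b c =>
        have h3 := simpleReduce_bound he hc b c hcA r hrc
        have h4 : (c.length : ℝ) ≤ m - 1 := by
          have : ((b :: c).length : ℝ) ≤ m := by exact_mod_cast hcl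
          push_cast [List.length_cons] at this
          linarith
        have := mul_le_mul_of_nonneg_left h4 he
        simp only [blockReduce]
        linarith
    nlinarith

theorem pairwiseReduce_mem (far : Pt → Pt → Prop) (d : Pt) (L : List Pt) (hL : L ≠ []) :
    pairwiseReduce far d L ∈ L := by
  induction hn : L.length using Nat.strong_induction_on generalizing L with | _ n ih
  match L with
  | [] => exact absurd rfl hL
  | [a] => simp [pairwiseReduce]
  | a :: b :: L =>
    rw [pairwiseReduce]
    set l := a :: b :: L with hl
    have hlen : 2 ≤ l.length := by simp [hl]
    have h₁ := List.mem_of_mem_take (ih _ (by rw [List.length_take]; omega)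
      (l.take (l.length / 2)) (by rw [← List.length_pos_iff, List.length_take]; omega) rfl)
    have h₂ := List.mem_of_mem_drop (ih _ (by rw [List.length_drop]; omega)
      (l.drop (l.length / 2)) (by rw [← List.length_pos_iff, List.length_drop]; omega) rfl)
    split_ifs
    · exact h₁
    · exact h₂

theorem pairwiseReduce_bound {far : Pt → Pt → Prop} {f : Pt → ℝ} {e : ℝ} {A : Set Pt} (he : 0 ≤ e)
    (hc : ComparesUpTo far f e A) (d : Pt) (L : List Pt) (hA : ∀ u ∈ L, u ∈ A) :
    ∀ r ∈ L, f r ≤ f (pairwiseReduce far d L) + e * (Nat.clog 2 L.length : ℝ) := by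
  induction hn : L.length using Nat.strong_induction_on generalizing L with | _ n ih
  match L with
  | [] => simp
  | [a] => simp [pairwiseReduce, ← hn]
  | a :: b :: L =>
    intro r hr
    rw [pairwiseReduce]
    set l := a :: b :: L with hl
    have hlen : 2 ≤ l.length := by simp [hl]
    have hA₁ : ∀ u ∈ l.take (l.length / 2), u ∈ A := fun u hu => hA u (List.mem_of_mem_take hu)
    have hA₂ : ∀ u ∈ l.drop (l.length / 2), u ∈ A := fun u hu => hA u (List.mem_of_mem_drop hu)
    have m₁ := hA₁ _ (pairwiseReduce_mem far d (l.take (l.length / 2)) (by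
      rw [← List.length_pos_iff, List.length_take]; omega))
    have m₂ := hA₂ _ (pairwiseReduce_mem far d (l.drop (l.length / 2)) (by
      rw [← List.length_pos_iff, List.length_drop]; omega))
    -- The larger half has `⌈n / 2⌉` elements, which is exactly the recursion of `Nat.clog 2`.
    have hclog : Nat.clog 2 l.length = Nat.clog 2 ((l.length + 1) / 2) + 1 := by
      rw [Nat.clog_of_two_le one_lt_two hlen]
      rfl
    have c₁ : (Nat.clog 2 (l.take (l.length / 2)).length : ℝ) ≤
        Nat.clog 2 ((l.length + 1) / 2) := by
      exact_mod_cast Nat.clog_mono_right 2 (by rw [List.length_take]; omega)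
    have c₂ : (Nat.clog 2 (l.drop (l.length / 2)).length : ℝ) ≤
        Nat.clog 2 ((l.length + 1) / 2) := by
      exact_mod_cast Nat.clog_mono_right 2 (by rw [List.length_drop]; omega)
    have c₁ := mul_le_mul_of_nonneg_left c₁ he
    have c₂ := mul_le_mul_of_nonneg_left c₂ he
    have hcmp := hc _ m₁ _ m₂
    rw [← hn, hclog]
    push_cast
    have hr' : r ∈ l.take (l.length / 2) ∨ r ∈ l.drop (l.length / 2) := by
      rw [← List.mem_append, List.take_append_drop]
      exact hr
    rcases hr' with h | h
    · have := ih _ (by rw [List.length_take]; omega) _ hA₁ rfl r h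
      split_ifs with hf
      · linarith
      · linarith [hcmp.2 hf]
    · have := ih _ (by rw [List.length_drop]; omega) _ hA₂ rfl r h
      split_ifs with hf
      · linarith [hcmp.1 hf]
      · linarith

theorem farthest_mem (fl : ℝ → ℝ) (s : Scheme) (p q : Pt) {L : List Pt} (hL : L ≠ []) :
    farthest fl s p q L ∈ L := by
  cases L with
  | nil => exact absurd rfl hL
  | cons a L =>
    cases s with
    | simple => exact simpleReduce_mem _ a L
    | blocked m => exact blockedReduce_mem _ m.pos a L
    | pairwise => exact pairwiseReduce_mem _ a _ hL

theorem farthest_mem_cons (fl : ℝ → ℝ) (s : Scheme) (p q : Pt) (L : List Pt) :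
    farthest fl s p q L ∈ p :: L := by
  rcases eq_or_ne L [] with rfl | hL
  · simp [farthest]
  · exact List.mem_cons_of_mem _ (farthest_mem fl s p q hL)

theorem farthest_bound {fl : ℝ → ℝ} {s : Scheme} {p q : Pt} {f : Pt → ℝ} {e : ℝ} {A : Set Pt}
    (he : 0 ≤ e) (hc : ComparesUpTo (frtHat fl p q) f e A) (L : List Pt) (hA : ∀ u ∈ L, u ∈ A) :
    ∀ r ∈ L, f r ≤ f (farthest fl s p q L) + e * chain s L.length := by
  cases L with
  | nil => simp
  | cons a L =>
    cases s with
    | simple => simpa [farthest, chain] using simpleReduce_bound he hc a L hA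
    | blocked m => exact blockedReduce_bound he hc m.pos a L hA
    | pairwise => exact pairwiseReduce_bound he hc a _ hA

/-! ### Distance to a line -/

theorem orient_eq (p u q : Pt) :
    orient p u q = (p 0 - u 0) * (q 1 - p 1) - (p 1 - u 1) * (q 0 - p 0) := by
  unfold orient
  ring

theorem dist_eq_sqrt (p q : Pt) : dist p q = √((p 0 - q 0) ^ 2 + (p 1 - q 1) ^ 2) := by
  rw [EuclideanSpace.dist_eq, Fin.sum_univ_two, Real.dist_eq, Real.dist_eq, sq_abs, sq_abs]

theorem dist_sq (p q : Pt) : dist p q ^ 2 = (p 0 - q 0) ^ 2 + (p 1 - q 1) ^ 2 := by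
  rw [dist_eq_sqrt, Real.sq_sqrt (by positivity)]

theorem abs_sub_apply_le_dist (p q : Pt) (i : Fin 2) : |p i - q i| ≤ dist p q := by
  refine abs_le_of_sq_le_sq ?_ dist_nonneg
  rw [dist_sq]
  fin_cases i <;> simp <;> positivity

theorem lineDist_eq {p q : Pt} (hpq : p ≠ q) (u : Pt) :
    lineDist u p q = |orient p u q| / dist p q := by
  have hd : 0 < dist p q := dist_pos.2 hpq
  have hd2 := dist_sq p q
  apply le_antisymm
  -- Parameter of the foot of the perpendicular from `u`.
  · set t : ℝ := ((u 0 - p 0) * (q 0 - p 0) + (u 1 - p 1) * (q 1 - p 1)) / dist p q ^ 2 with ht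
    have htd : t * dist p q ^ 2 = (u 0 - p 0) * (q 0 - p 0) + (u 1 - p 1) * (q 1 - p 1) := by
      rw [ht]
      field_simp
    refine (Metric.infDist_le_dist_of_mem (AffineMap.lineMap_mem_affineSpan_pair t p q)).trans ?_
    rw [le_div_iff₀ hd, ← abs_of_pos hd, ← abs_of_nonneg (dist_nonneg (x := u)), ← abs_mul]
    apply sq_le_sq.1
    rw [mul_pow, dist_sq, orient_eq]
    simp only [AffineMap.lineMap_apply, vsub_eq_sub, vadd_eq_add, PiLp.add_apply, PiLp.smul_apply,
      PiLp.sub_apply, smul_eq_mul]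
    rw [hd2] at htd ⊢
    have : t ^ 2 * ((p 0 - q 0) ^ 2 + (p 1 - q 1) ^ 2) = t * ((u 0 - p 0) * (q 0 - p 0) +
      (u 1 - p 1) * (q 1 - p 1)) := by rw [← htd]; ring
    nlinarith
  · refine (Metric.le_infDist ⟨p, left_mem_affineSpan_pair ℝ p q⟩).2 ?_
    intro v hv
    obtain ⟨t, rfl⟩ := mem_affineSpan_pair_iff_exists_lineMap_eq.1 hv
    rw [div_le_iff₀ hd, ← abs_of_pos hd, ← abs_of_nonneg (dist_nonneg (x := u)), ← abs_mul]
    apply sq_le_sq.1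
    rw [mul_pow, dist_sq, dist_sq, orient_eq]
    simp only [AffineMap.lineMap_apply, vsub_eq_sub, vadd_eq_add, PiLp.add_apply, PiLp.smul_apply,
      PiLp.sub_apply, smul_eq_mul]
    -- Lagrange's identity: the two sides differ by the square of the inner product of `u - v` and
    -- `q - p`.
    nlinarith [sq_nonneg ((u 0 - (t * (q 0 - p 0) + p 0)) * (q 0 - p 0) +
      (u 1 - (t * (q 1 - p 1) + p 1)) * (q 1 - p 1))]

theorem abs_apply_le_maxCoord {P : List Pt} {u : Pt} (hu : u ∈ P) (i : Fin 2) :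
    |u i| ≤ maxCoord P := by
  induction P with
  | nil => simp at hu
  | cons a P ih =>
    change _ ≤ max (max |a 0| |a 1|) (maxCoord P)
    rcases List.mem_cons.1 hu with rfl | hu
    · refine le_max_of_le_left ?_
      fin_cases i <;> simp
    · exact le_max_of_le_right (ih hu)

theorem maxCoord_nonneg (P : List Pt) : 0 ≤ maxCoord P := by
  induction P with
  | nil => simp [maxCoord]
  | cons a P ih => exact le_max_of_le_right ih

theorem maxCoord_pos {P : List Pt} {p q : Pt} (hp : p ∈ P) (hq : q ∈ P) (hpq : p ≠ q) :
    0 < maxCoord P := by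
  refine (maxCoord_nonneg P).lt_of_ne fun h => hpq ?_
  ext i
  have h1 := abs_apply_le_maxCoord hp i
  have h2 := abs_apply_le_maxCoord hq i
  rw [← h] at h1 h2
  rw [abs_nonpos_iff.1 h1, abs_nonpos_iff.1 h2]

theorem abs_sub_le_two_mul {x y M : ℝ} (hx : |x| ≤ M) (hy : |y| ≤ M) : |x - y| ≤ 2 * M := by
  linarith [abs_sub x y]

/-- The two compared products differ by exactly the difference of the orientations. The factor `dist
p q` in the error disappears when orientations are turned into distances. -/
theorem frtHat_comparesUpTo {fl : ℝ → ℝ} {ε M : ℝ} (h : IsRounding fl ε) (hε : 0 ≤ ε)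
    (hε' : 6 * ε < 1) (p q : Pt) :
    ComparesUpTo (frtHat fl p q) (fun u => orient p u q) (gamma6 ε * (dist p q * (2 * M)))
      {u | ∀ i, |u i| ≤ M} := by
  intro u hu v hv
  have hγ := gamma6_nonneg hε hε'
  have hB : |(q 0 - p 0) * (u 1 - v 1)| ≤ dist p q * (2 * M) := by
    rw [abs_mul, dist_comm]
    exact mul_le_mul (abs_sub_apply_le_dist q p 0) (abs_sub_le_two_mul (hu 1) (hv 1))
      (abs_nonneg _) dist_nonneg
  have e : orient p u q - orient p v q =
      (q 0 - p 0) * (u 1 - v 1) - (q 1 - p 1) * (u 0 - v 0) := by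
    rw [orient_eq, orient_eq]
    ring
  refine ⟨fun hf => ?_, fun hf => ?_⟩
  · have := h.sub_le_of_le hε hε' (le_of_lt hf)
    have := this.trans (mul_le_mul_of_nonneg_left ((min_le_right _ _).trans hB) hγ)
    dsimp only
    linarith
  · have := h.sub_le_of_le hε hε' (not_lt.1 hf)
    have := this.trans (mul_le_mul_of_nonneg_left ((min_le_left _ _).trans hB) hγ)
    dsimp only
    linarith

theorem isReductionBound_gamma6 {fl : ℝ → ℝ} {ε : ℝ} (h : IsRounding fl ε) (hε : 0 ≤ ε)
    (hε' : 6 * ε < 1) (s : Scheme) :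
    IsReductionBound fl s (fun n => 2 * gamma6 ε * chain s n) := by
  intro L p q hL hpq hleft r hr
  have hM : 0 < maxCoord (p :: q :: L) := maxCoord_pos (p := p) (q := q) (by simp) (by simp) hpq
  have hd : 0 < dist p q := dist_pos.2 hpq
  have hγ := gamma6_nonneg hε hε'
  have key := farthest_bound (s := s) (mul_nonneg hγ (by positivity))
    (frtHat_comparesUpTo (M := maxCoord (p :: q :: L)) h hε hε' p q) L
    (fun u hu i => abs_apply_le_maxCoord (by simp [hu]) i) r hr
  rw [div_le_iff₀ hM, lineDist_eq hpq, lineDist_eq hpq, abs_of_pos (hleft r hr),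
    abs_of_pos (hleft _ (farthest_mem fl s p q hL)), ← sub_div, div_le_iff₀ hd]
  linarith

/-! ### Vertical distance to the computed hull -/

/-- If `u` lies in the vertical strip between `p` and `q`, the segment `pq` has a point above or below
`u`, and its vertical distance to `u` is determined by the orientation. -/
theorem exists_mem_segment_vertical {p q u : Pt} {σ : ℝ} (hpq : 0 < σ * (q 0 - p 0))
    (hpu : 0 ≤ σ * (u 0 - p 0)) (huq : 0 ≤ σ * (q 0 - u 0)) :
    ∃ z ∈ segment ℝ p q, z 0 = u 0 ∧ orient p u q = (q 0 - p 0) * (u 1 - z 1) := by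
  have hd : q 0 - p 0 ≠ 0 := by
    intro h
    simp [h] at hpq
  have hσ : σ ≠ 0 := by
    rintro rfl
    simp at hpq
  set t : ℝ := (u 0 - p 0) / (q 0 - p 0) with ht
  have htd : t * (q 0 - p 0) = u 0 - p 0 := by
    rw [ht]
    field_simp
  have ht' : t = σ * (u 0 - p 0) / (σ * (q 0 - p 0)) := by
    rw [ht]
    field_simp
  have ht0 : 0 ≤ t := by
    rw [ht']
    positivity
  have ht1 : t ≤ 1 := by
    rw [ht', div_le_one hpq]
    linarith
  refine ⟨AffineMap.lineMap p q t, ?_, ?_, ?_⟩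
  · rw [segment_eq_image_lineMap]
    exact ⟨t, ⟨ht0, ht1⟩, rfl⟩
  · simp only [AffineMap.lineMap_apply, vsub_eq_sub, vadd_eq_add, PiLp.add_apply, PiLp.smul_apply,
      PiLp.sub_apply, smul_eq_mul]
    linarith
  · rw [orient_eq]
    simp only [AffineMap.lineMap_apply, vsub_eq_sub, vadd_eq_add, PiLp.add_apply, PiLp.smul_apply,
      PiLp.sub_apply, smul_eq_mul]
    linear_combination (q 1 - p 1) * htd

theorem abs_eq_mul_of_pos {σ d : ℝ} (hσ : σ * σ = 1) (h : 0 < σ * d) : |d| = σ * d := by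
  rcases mul_self_eq_one_iff.1 hσ with rfl | rfl
  · rw [one_mul] at h ⊢
    exact abs_of_pos h
  · rw [neg_one_mul] at h ⊢
    exact abs_of_neg (by linarith)

/-- A point in the strip between `p` and `q` that is computed to be to the left of `pq` is, up to
`2γ₆M`, on the left side of the segment in the vertical direction. -/
theorem exists_vertical_of_rtHat {fl : ℝ → ℝ} {ε M σ : ℝ} (h : IsRounding fl ε) (hε : 0 ≤ ε)
    (hε' : 6 * ε < 1) (hσ : σ * σ = 1) {p q u : Pt} (hp : |p 1| ≤ M) (hu : |u 1| ≤ M)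
    (hpq : 0 < σ * (q 0 - p 0)) (hpu : 0 ≤ σ * (u 0 - p 0)) (huq : 0 ≤ σ * (q 0 - u 0))
    (hrt : rtHat fl p u q) :
    ∃ z ∈ segment ℝ p q, z 0 = u 0 ∧ σ * (z 1 - u 1) ≤ 2 * gamma6 ε * M := by
  obtain ⟨z, hz, hz0, ho⟩ := exists_mem_segment_vertical hpq hpu huq
  refine ⟨z, hz, hz0, ?_⟩
  have h1 := (h.sub_le_of_le hε hε' (le_of_lt hrt)).trans
    (mul_le_mul_of_nonneg_left (min_le_left _ _) (gamma6_nonneg hε hε'))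
  -- Of the two products in the minimum, the one containing `q 0 - p 0` is used, so that this factor
  -- can be cancelled.
  rw [abs_mul, abs_eq_mul_of_pos hσ hpq] at h1
  rw [orient_eq] at ho
  have h2 : |p 1 - u 1| * (σ * (q 0 - p 0)) ≤ 2 * M * (σ * (q 0 - p 0)) :=
    mul_le_mul_of_nonneg_right (abs_sub_le_two_mul hp hu) hpq.le
  have h3 := h1.trans (mul_le_mul_of_nonneg_left h2 (gamma6_nonneg hε hε'))
  refine le_of_mul_le_mul_right ?_ hpq
  calc σ * (z 1 - u 1) * (σ * (q 0 - p 0)) = (σ * σ) * ((q 0 - p 0) * (z 1 - u 1)) := by ring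
    _ ≤ _ := by rw [hσ]; linarith

/-- A point in the strip between `p` and `q` that is not computed to be to the left of `pq` is, up to
`2γ₆M`, on the right side of the segment in the vertical direction. -/
theorem exists_vertical_of_not_rtHat {fl : ℝ → ℝ} {ε M σ : ℝ} (h : IsRounding fl ε) (hε : 0 ≤ ε)
    (hε' : 6 * ε < 1) (hσ : σ * σ = 1) {p q u : Pt} (hp : |p 1| ≤ M) (hu : |u 1| ≤ M)
    (hpq : 0 < σ * (q 0 - p 0)) (hpu : 0 ≤ σ * (u 0 - p 0)) (huq : 0 ≤ σ * (q 0 - u 0))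
    (hrt : ¬ rtHat fl p u q) :
    ∃ z ∈ segment ℝ p q, z 0 = u 0 ∧ σ * (u 1 - z 1) ≤ 2 * gamma6 ε * M := by
  obtain ⟨z, hz, hz0, ho⟩ := exists_mem_segment_vertical hpq hpu huq
  refine ⟨z, hz, hz0, ?_⟩
  have h1 := (h.sub_le_of_le hε hε' (not_lt.1 hrt)).trans
    (mul_le_mul_of_nonneg_left (min_le_right _ _) (gamma6_nonneg hε hε'))
  rw [abs_mul, abs_eq_mul_of_pos hσ hpq] at h1
  rw [orient_eq] at ho
  have h2 : |p 1 - u 1| * (σ * (q 0 - p 0)) ≤ 2 * M * (σ * (q 0 - p 0)) :=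
    mul_le_mul_of_nonneg_right (abs_sub_le_two_mul hp hu) hpq.le
  have h3 := h1.trans (mul_le_mul_of_nonneg_left h2 (gamma6_nonneg hε hε'))
  refine le_of_mul_le_mul_right ?_ hpq
  calc σ * (u 1 - z 1) * (σ * (q 0 - p 0)) = (σ * σ) * ((q 0 - p 0) * (u 1 - z 1)) := by ring
    _ ≤ _ := by rw [hσ]; linarith

theorem dist_le_of_vertical {u z : Pt} {e : ℝ} (h0 : z 0 = u 0) (h1 : |u 1 - z 1| ≤ e) :
    dist u z ≤ e := by
  rwa [dist_eq_sqrt, h0, sub_self, zero_pow two_ne_zero, zero_add, Real.sqrt_sq_eq_abs]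

/-- A convex set that has points below and above `u`, up to the error `e`, is within `e` of `u`. -/
theorem exists_dist_le_of_vertical {S : Set Pt} (hS : Convex ℝ S) {u z z' : Pt} {σ e : ℝ}
    (hσ : σ * σ = 1) (hz : z ∈ S) (hz' : z' ∈ S) (h0 : z 0 = u 0) (h0' : z' 0 = u 0)
    (h : σ * (z 1 - u 1) ≤ e) (h' : σ * (u 1 - z' 1) ≤ e) (he : 0 ≤ e) :
    ∃ y ∈ S, dist u y ≤ e := by
  have habs : ∀ x : ℝ, |x| = |σ * x| := fun x => by
    rw [abs_mul, show |σ| = 1 from by rcases mul_self_eq_one_iff.1 hσ with rfl | rfl <;> simp,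
      one_mul]
  rcases le_or_gt 0 (σ * (z 1 - u 1)) with h1 | h1
  · refine ⟨z, hz, dist_le_of_vertical h0 ?_⟩
    rw [abs_sub_comm, habs, abs_of_nonneg h1]
    exact h
  rcases le_or_gt 0 (σ * (u 1 - z' 1)) with h2 | h2
  · refine ⟨z', hz', dist_le_of_vertical h0' ?_⟩
    rw [habs, abs_of_nonneg h2]
    exact h'
  refine ⟨u, hS.segment_subset hz hz' ?_, by simpa using he⟩
  have hd : 0 < σ * (z' 1 - z 1) := by linarith
  have hd0 : z' 1 - z 1 ≠ 0 := by
    intro h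
    simp [h] at hd
  have hσ0 : σ ≠ 0 := by
    rintro rfl
    simp at hσ
  set t : ℝ := (u 1 - z 1) / (z' 1 - z 1) with ht
  have ht' : t = σ * (u 1 - z 1) / (σ * (z' 1 - z 1)) := by
    rw [ht]
    field_simp
  rw [segment_eq_image_lineMap]
  refine ⟨t, ⟨?_, ?_⟩, ?_⟩
  · rw [ht']
    exact div_nonneg (by linarith) hd.le
  · rw [ht', div_le_one hd]
    linarith
  · ext i
    fin_cases i
    · simp [AffineMap.lineMap_apply, h0, h0']
    · simp only [AffineMap.lineMap_apply, vsub_eq_sub, vadd_eq_add, PiLp.add_apply,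
        PiLp.smul_apply, PiLp.sub_apply, smul_eq_mul, Fin.mk_one, Fin.isValue]
      rw [ht]
      field_simp
      ring

/-! ### Following a point through the recursion -/

theorem mem_leftOf {fl : ℝ → ℝ} {p q u : Pt} {L : List Pt} :
    u ∈ leftOf fl p q L ↔ u ∈ L ∧ rtHat fl p u q := by
  simp [leftOf]

theorem mem_CH {P : List Pt} {u : Pt} (h : u ∈ P) : u ∈ CH P := subset_convexHull ℝ _ h

theorem CH_mono {P Q : List Pt} (h : ∀ u ∈ P, u ∈ Q) : CH P ⊆ CH Q := convexHull_mono h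

theorem convex_CH (P : List Pt) : Convex ℝ (CH P) := convex_convexHull ℝ _

theorem segment_subset_CH {P : List Pt} {u v : Pt} (hu : u ∈ P) (hv : v ∈ P) :
    segment ℝ u v ⊆ CH P :=
  (convex_CH P).segment_subset (mem_CH hu) (mem_CH hv)

theorem HullRun.subset {fl : ℝ → ℝ} {s : Scheme} {L H : List Pt} {p r q : Pt} {D : ℕ}
    (hrun : HullRun fl s L p r q H D) (hr : r ∈ p :: L) : ∀ v ∈ H, v ∈ p :: q :: L := by
  induction hrun with
  | base L p r q hL => exact fun v hv => by simp [hv]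
  | step L p r q H₁ H₂ D₁ D₂ hL h₁ h₂ ih₁ ih₂ =>
    have ih₁ := ih₁ (farthest_mem_cons ..)
    have ih₂ := ih₂ (farthest_mem_cons ..)
    simp only [List.mem_cons, mem_leftOf] at ih₁ ih₂ hr
    intro v hv
    simp only [List.mem_append, List.mem_cons, List.not_mem_nil, or_false] at hv ⊢
    rcases hv with (((rfl | hv) | rfl) | hv) | rfl
    · simp
    · rcases ih₁ v hv with rfl | rfl | hv <;> tauto
    · tauto
    · rcases ih₂ v hv with rfl | rfl | hv <;> tauto
    · simp

/-- Every point handled by `HULL` that lies in the strip between `p` and `q` is within `2γ₆M` of the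
computed hull: it can be followed through calls for which it stays in the strip, until it is either
output or enclosed vertically by two edges. -/
theorem HullRun.exists_dist_le {fl : ℝ → ℝ} {ε M σ : ℝ} (h : IsRounding fl ε) (hε : 0 ≤ ε)
    (hε' : 6 * ε < 1) (hσ : σ * σ = 1) {s : Scheme} {L H : List Pt} {p r q : Pt} {D : ℕ}
    (hrun : HullRun fl s L p r q H D) (hr : r ∈ p :: L)
    (hM : ∀ v ∈ p :: q :: L, |v 1| ≤ M) (hpq : 0 < σ * (q 0 - p 0)) {u : Pt} (hu : u ∈ L)
    (hpu : 0 ≤ σ * (u 0 - p 0)) (huq : 0 ≤ σ * (q 0 - u 0)) (hrt : rtHat fl p u q) :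
    ∃ y ∈ CH (p :: q :: H), dist u y ≤ 2 * gamma6 ε * M := by
  have hγ := gamma6_nonneg hε hε'
  have he : 0 ≤ 2 * gamma6 ε * M :=
    mul_nonneg (by positivity) ((abs_nonneg _).trans (hM p (by simp)))
  induction hrun with
  | base L p r q hL => exact ⟨u, mem_CH (by simp [hu]), by simpa using he⟩
  | step L p r q H₁ H₂ D₁ D₂ hL h₁ h₂ ih₁ ih₂ =>
    have hMp : |p 1| ≤ M := hM p (by simp)
    have hMq : |q 1| ≤ M := hM q (by simp)
    have hMu : |u 1| ≤ M := hM u (by simp [hu])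
    have hMr : |r 1| ≤ M := hM r (by
      rcases List.mem_cons.1 hr with rfl | hr
      · simp
      · simp [hr])
    set H := [p] ++ H₁ ++ [r] ++ H₂ ++ [q] with hH
    have hpH : p ∈ p :: q :: H := by simp
    have hqH : q ∈ p :: q :: H := by simp
    have hrH : r ∈ p :: q :: H := by simp [hH]
    obtain ⟨z, hz, hz0, hzu⟩ := exists_vertical_of_rtHat h hε hε' hσ hMp hMu hpq hpu huq hrt
    -- No position of `r` relative to the strip is assumed: even if `r` lies outside it, `u` is in
    -- the strip of one of the two new edges, and that edge is not vertical.
    have hside : (0 < σ * (r 0 - p 0) ∧ 0 ≤ σ * (r 0 - u 0)) ∨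
        (0 < σ * (q 0 - r 0) ∧ 0 ≤ σ * (u 0 - r 0)) := by
      rcases le_or_gt 0 (σ * (r 0 - u 0)) with h1 | h1
      · rcases lt_or_ge 0 (σ * (r 0 - p 0)) with h2 | h2
        · exact .inl ⟨h2, h1⟩
        · exact .inr ⟨by linarith, by linarith⟩
      · exact .inr ⟨by linarith, by linarith⟩
    rcases hside with ⟨hpr, hur⟩ | ⟨hrq, hru⟩
    · by_cases hrt' : rtHat fl p u r
      · obtain ⟨y, hy, hyu⟩ := ih₁ (farthest_mem_cons ..) (by
          intro v hv
          rcases (by simpa [mem_leftOf] using hv : v = p ∨ v = r ∨ v ∈ L ∧ _) with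
            rfl | rfl | ⟨hv, -⟩
          · exact hMp
          · exact hMr
          · exact hM v (by simp [hv])) hpr (mem_leftOf.2 ⟨hu, hrt'⟩) hpu hur hrt'
        refine ⟨y, CH_mono ?_ hy, hyu⟩
        intro v hv
        simp only [List.mem_cons] at hv
        rcases hv with rfl | rfl | hv
        exacts [by simp [hH], by simp [hH], by simp [hH, hv]]
      -- The test against `pq` was passed and the one against `pr` failed: `u` is enclosed between
      -- these segments.
      · obtain ⟨z', hz', hz0', hzu'⟩ :=
          exists_vertical_of_not_rtHat h hε hε' hσ hMp hMu hpr hpu hur hrt'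
        exact exists_dist_le_of_vertical (convex_CH _) hσ (segment_subset_CH hpH hqH hz)
          (segment_subset_CH hpH hrH hz') hz0 hz0' hzu hzu' he
    · by_cases hrt' : rtHat fl r u q
      · obtain ⟨y, hy, hyu⟩ := ih₂ (farthest_mem_cons ..) (by
          intro v hv
          rcases (by simpa [mem_leftOf] using hv : v = r ∨ v = q ∨ v ∈ L ∧ _) with
            rfl | rfl | ⟨hv, -⟩
          · exact hMr
          · exact hMq
          · exact hM v (by simp [hv])) hrq (mem_leftOf.2 ⟨hu, hrt'⟩) hru huq hrt'
        refine ⟨y, CH_mono ?_ hy, hyu⟩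
        intro v hv
        simp only [List.mem_cons] at hv
        rcases hv with rfl | rfl | hv
        exacts [by simp [hH], by simp [hH], by simp [hH, hv]]
      · obtain ⟨z', hz', hz0', hzu'⟩ :=
          exists_vertical_of_not_rtHat h hε hε' hσ hMr hMu hrq hru huq hrt'
        exact exists_dist_le_of_vertical (convex_CH _) hσ (segment_subset_CH hpH hqH hz)
          (segment_subset_CH hrH hqH hz') hz0 hz0' hzu hzu' he

/-! ### The forward error -/

open scoped Pointwise in
theorem forwardError_le {H P : List Pt} {e : ℝ} (he : 0 ≤ e) (hHP : ∀ v ∈ H, v ∈ P)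
    (h : ∀ u ∈ P, ∃ y ∈ CH H, dist u y ≤ e * maxCoord P) : forwardError H P ≤ e := by
  have hM := maxCoord_nonneg P
  have heM : 0 ≤ e * maxCoord P := mul_nonneg he hM
  refine div_le_of_le_mul₀ hM he (Metric.hausdorffDist_le_of_mem_dist heM ?_ ?_)
  · exact fun x hx => ⟨x, CH_mono hHP hx, by simpa using heM⟩
  · intro x hx
    -- The closed neighbourhood of a convex set is convex, so it contains `CH P` once it contains
    -- the points of `P`.
    have hsub : CH P ⊆ CH H + Metric.closedBall (0 : Pt) (e * maxCoord P) := by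
      refine convexHull_min ?_ ((convex_CH H).add (convex_closedBall _ _))
      intro u hu
      obtain ⟨y, hy, hd⟩ := h u hu
      exact Set.mem_add.2 ⟨y, hy, u - y, by simpa [← dist_eq_norm] using hd, by abel⟩
    obtain ⟨y, hy, b, hb, rfl⟩ := Set.mem_add.1 (hsub hx)
    exact ⟨y, hy, by simpa using hb⟩

theorem forwardError_eq_zero {H P : List Pt} (hHP : ∀ v, v ∈ H ↔ v ∈ P) : forwardError H P = 0 := by
  have : CH H = CH P := by
    unfold CH
    simp only [hHP]
  rw [forwardError, this, Metric.hausdorffDist_self_zero, zero_div]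

theorem not_rtHat_of_eq {fl : ℝ → ℝ} {ε : ℝ} (h : IsRounding fl ε) {p u q : Pt}
    (hu : u 0 = p 0) (hq : q 0 = p 0) : ¬ rtHat fl p u q := by
  simp [rtHat, hu, hq, h.map_zero]

theorem not_rtHat_left {fl : ℝ → ℝ} {ε : ℝ} (h : IsRounding fl ε) (p q : Pt) :
    ¬ rtHat fl p p q := by
  simp [rtHat, h.map_zero]

theorem HullRun.forwardError_le_two_gamma6 {fl : ℝ → ℝ} {ε : ℝ} (h : IsRounding fl ε) (hε : 0 ≤ ε)
    (hε' : 6 * ε < 1) {s : Scheme} {L H : List Pt} {p q : Pt} {D : ℕ}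
    (hstrip : (∀ u ∈ L, p 0 ≤ u 0 ∧ u 0 ≤ q 0) ∨ (∀ u ∈ L, q 0 ≤ u 0 ∧ u 0 ≤ p 0))
    (hL : ∀ u ∈ L, rtHat fl p u q) (hrun : HullRun fl s L p (farthest fl s p q L) q H D) :
    forwardError (p :: q :: H) (p :: q :: L) ≤ 2 * gamma6 ε := by
  have hγ := gamma6_nonneg hε hε'
  have hr := farthest_mem_cons fl s p q L
  have hM : ∀ v ∈ p :: q :: L, |v 1| ≤ maxCoord (p :: q :: L) :=
    fun v hv => abs_apply_le_maxCoord hv 1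
  have heM := mul_nonneg (mul_nonneg zero_le_two hγ) (maxCoord_nonneg (p :: q :: L))
  refine forwardError_le (by positivity) ?_ ?_
  · intro v hv
    rcases (by simpa using hv : v = p ∨ v = q ∨ v ∈ H) with rfl | rfl | hv
    · simp
    · simp
    · exact hrun.subset hr v hv
  · intro u hu
    rcases (by simpa using hu : u = p ∨ u = q ∨ u ∈ L) with rfl | rfl | hu
    · exact ⟨u, mem_CH (by simp), by simpa using heM⟩
    · exact ⟨u, mem_CH (by simp), by simpa using heM⟩
    · have hrt := hL u hu
      rcases hstrip with hs | hs
      · obtain ⟨h1, h2⟩ := hs u hu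
        -- In a degenerate strip both computed products are `0`, and the strict test would fail.
        have hlt : p 0 < q 0 := (h1.trans h2).lt_of_ne fun he =>
          not_rtHat_of_eq h (le_antisymm (h2.trans he.ge) h1) he.symm hrt
        exact hrun.exists_dist_le h hε hε' (σ := 1) (by norm_num) hr hM (by linarith) hu
          (by linarith) (by linarith) hrt
      · obtain ⟨h1, h2⟩ := hs u hu
        have hlt : q 0 < p 0 := (h1.trans h2).lt_of_ne fun he =>
          not_rtHat_of_eq h (le_antisymm h2 (he.ge.trans h1)) he hrt
        exact hrun.exists_dist_le h hε hε' (σ := -1) (by norm_num) hr hM (by linarith) hu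
          (by linarith) (by linarith) hrt

/-- At depth `0` the output is `L` itself and the error vanishes; a recursive step forces `2 ≤
L.length` and `1 ≤ D`, so `2γ₆ ≤ 2Dx`. -/
theorem HullRun.forwardError_le {fl : ℝ → ℝ} {ε : ℝ} (h : IsRounding fl ε) (hε : 0 ≤ ε)
    (hε' : 6 * ε < 1) {s : Scheme} {L H : List Pt} {p q : Pt} {D : ℕ}
    (hstrip : (∀ u ∈ L, p 0 ≤ u 0 ∧ u 0 ≤ q 0) ∨ (∀ u ∈ L, q 0 ≤ u 0 ∧ u 0 ≤ p 0))
    (hL : ∀ u ∈ L, rtHat fl p u q) (hrun : HullRun fl s L p (farthest fl s p q L) q H D)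
    {x : ℝ} (hx : 2 ≤ L.length → gamma6 ε ≤ x) :
    forwardError (p :: q :: H) (p :: q :: L) ≤ 2 * D * x := by
  have key := hrun.forwardError_le_two_gamma6 h hε hε' hstrip hL
  have hγ := gamma6_nonneg hε hε'
  cases hrun with
  | base _ _ _ _ hlen => simpa using (forwardError_eq_zero fun v => Iff.rfl).le
  | step _ _ _ _ H₁ H₂ D₁ D₂ hlen h₁ h₂ =>
    have hx := hx hlen
    push_cast
    have : (0 : ℝ) ≤ max (D₁ : ℝ) (D₂ : ℝ) := le_max_of_le_left (Nat.cast_nonneg _)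
    nlinarith

/-! ### Forward error of Quickhull -/

theorem IsExtremePair.nonempty {P : List Pt} {p q : Pt} (h : IsExtremePair P p q) : P ≠ [] :=
  List.ne_nil_of_mem h.1

theorem QuickhullRun.nonempty {fl : ℝ → ℝ} {s : Scheme} {P H : List Pt} {D : ℕ}
    (hrun : QuickhullRun fl s P H D) : P ≠ [] := by
  obtain ⟨p, q, H₁, H₂, D₁, D₂, hpq, -⟩ := hrun
  exact hpq.nonempty

theorem QuickhullRun.one_le_depth {fl : ℝ → ℝ} {s : Scheme} {P H : List Pt} {D : ℕ}
    (hrun : QuickhullRun fl s P H D) : 1 ≤ D := by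
  obtain ⟨p, q, H₁, H₂, D₁, D₂, -, -, -, -, rfl⟩ := hrun
  omega

theorem QuickhullRun.subset {fl : ℝ → ℝ} {s : Scheme} {P H : List Pt} {D : ℕ}
    (hrun : QuickhullRun fl s P H D) : ∀ v ∈ H, v ∈ P := by
  obtain ⟨p, q, H₁, H₂, D₁, D₂, ⟨hp, hq, -⟩, h₁, h₂, rfl, rfl⟩ := hrun
  have h₁ := h₁.subset (farthest_mem_cons ..)
  have h₂ := h₂.subset (farthest_mem_cons ..)
  simp only [List.mem_cons, mem_leftOf] at h₁ h₂
  intro v hv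
  simp only [List.mem_append, List.mem_cons, List.not_mem_nil, or_false] at hv
  rcases hv with ((rfl | hv) | rfl) | hv
  · exact hp
  · rcases h₁ v hv with rfl | rfl | hv <;> tauto
  · exact hq
  · rcases h₂ v hv with rfl | rfl | hv <;> tauto

/-- The forward error of Quickhull never exceeds `2γ₆`. -/
theorem QuickhullRun.forwardError_le_two_gamma6 {fl : ℝ → ℝ} {ε : ℝ} (h : IsRounding fl ε)
    (hε : 0 ≤ ε) (hε' : 6 * ε < 1) {s : Scheme} {P H : List Pt} {D : ℕ}
    (hrun : QuickhullRun fl s P H D) : forwardError H P ≤ 2 * gamma6 ε := by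
  have hγ := gamma6_nonneg hε hε'
  refine FloatQuickhull.forwardError_le (by positivity) hrun.subset ?_
  have heM := mul_nonneg (mul_nonneg zero_le_two hγ) (maxCoord_nonneg P)
  have hM : ∀ v ∈ P, |v 1| ≤ maxCoord P := fun v hv => abs_apply_le_maxCoord hv 1
  obtain ⟨p, q, H₁, H₂, D₁, D₂, ⟨hp, hq, hext, hvert⟩, h₁, h₂, rfl, rfl⟩ := hrun
  set H := [p] ++ H₁ ++ [q] ++ H₂ with hH
  have hpH : p ∈ H := by simp [hH]
  have hqH : q ∈ H := by simp [hH]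
  intro u hu
  obtain ⟨hpu, huq⟩ := hext u hu
  rcases (hpu.trans huq).eq_or_lt with heq | hlt
  -- All points lie on one vertical line; the tie rule places `u` on the segment from `p` up to `q`.
  · obtain ⟨h1, h2⟩ := hvert heq u hu
    exact exists_dist_le_of_vertical (σ := 1) (convex_CH _) (by norm_num) (mem_CH hpH)
      (mem_CH hqH) (le_antisymm hpu (by linarith)) (le_antisymm (by linarith) huq)
      (by linarith) (by linarith) heM
  · have hM₁ : ∀ v ∈ p :: q :: leftOf fl p q P, |v 1| ≤ maxCoord P := by
      intro v hv
      rcases (by simpa [mem_leftOf] using hv : v = p ∨ v = q ∨ v ∈ P ∧ _) with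
        rfl | rfl | ⟨hv, -⟩
      exacts [hM _ hp, hM _ hq, hM _ hv]
    have hM₂ : ∀ v ∈ q :: p :: leftOf fl q p P, |v 1| ≤ maxCoord P := by
      intro v hv
      rcases (by simpa [mem_leftOf] using hv : v = q ∨ v = p ∨ v ∈ P ∧ _) with
        rfl | rfl | ⟨hv, -⟩
      exacts [hM _ hq, hM _ hp, hM _ hv]
    by_cases hrt₁ : rtHat fl p u q
    · obtain ⟨y, hy, hyu⟩ := h₁.exists_dist_le h hε hε' (σ := 1) (by norm_num)
        (farthest_mem_cons ..) hM₁ (by linarith) (mem_leftOf.2 ⟨hu, hrt₁⟩) (by linarith)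
        (by linarith) hrt₁
      refine ⟨y, CH_mono ?_ hy, hyu⟩
      intro v hv
      simp only [List.mem_cons] at hv
      rcases hv with rfl | rfl | hv
      exacts [by simp [hH], by simp [hH], by simp [hH, hv]]
    by_cases hrt₂ : rtHat fl q u p
    · obtain ⟨y, hy, hyu⟩ := h₂.exists_dist_le h hε hε' (σ := -1) (by norm_num)
        (farthest_mem_cons ..) hM₂ (by linarith) (mem_leftOf.2 ⟨hu, hrt₂⟩) (by linarith)
        (by linarith) hrt₂
      refine ⟨y, CH_mono ?_ hy, hyu⟩
      intro v hv
      simp only [List.mem_cons] at hv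
      rcases hv with rfl | rfl | hv
      exacts [by simp [hH], by simp [hH], by simp [hH, hv]]
    -- A point discarded by both initial tests is close to the segment `pq` from either side.
    · obtain ⟨z, hz, hz0, hzu⟩ := exists_vertical_of_not_rtHat (σ := 1) h hε hε' (by norm_num)
        (hM p hp) (hM u hu) (by linarith) (by linarith) (by linarith) hrt₁
      obtain ⟨z', hz', hz0', hzu'⟩ := exists_vertical_of_not_rtHat (σ := -1) h hε hε'
        (by norm_num) (hM q hq) (hM u hu) (by linarith) (by linarith) (by linarith) hrt₂
      exact exists_dist_le_of_vertical (σ := 1) (convex_CH _) (by norm_num)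
        (segment_subset_CH hqH hpH hz') (segment_subset_CH hpH hqH hz) hz0' hz0
        (by linarith) hzu heM

theorem QuickhullRun.forwardError_le {fl : ℝ → ℝ} {ε : ℝ} (h : IsRounding fl ε) (hε : 0 ≤ ε)
    (hε' : 6 * ε < 1) {s : Scheme} {P H : List Pt} {D : ℕ} (hrun : QuickhullRun fl s P H D)
    {x : ℝ} (hx₁ : P.length = 1 → 0 ≤ x) (hx : 2 ≤ P.length → gamma6 ε ≤ x) :
    forwardError H P ≤ 2 * D * x := by
  have hD : (1 : ℝ) ≤ D := by exact_mod_cast hrun.one_le_depth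
  have hγ := gamma6_nonneg hε hε'
  rcases lt_or_ge P.length 2 with hlt | hge
  · have hlen : P.length = 1 := by
      have := List.length_pos_iff.2 hrun.nonempty
      omega
    have hx₁ := hx₁ hlen
    have hsub := hrun.subset
    obtain ⟨a, rfl⟩ := List.length_eq_one_iff.1 hlen
    obtain ⟨p, q, H₁, H₂, D₁, D₂, ⟨hp, -⟩, -, -, rfl, rfl⟩ := hrun
    obtain rfl : p = a := by simpa using hp
    rw [forwardError_eq_zero fun v => ⟨hsub v, fun hv => by
      obtain rfl : v = p := by simpa using hv
      simp⟩]
    positivity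
  · have := hrun.forwardError_le_two_gamma6 h hε hε'
    have := hx hge
    nlinarith

/-! ### Bounds for the reduction -/

/-- Any one-point list has reduction error `0`. This supplies the sign of `F 1` when `P` is a single
point. -/
theorem IsReductionBound.nonneg {fl : ℝ → ℝ} {s : Scheme} {F : ℕ → ℝ}
    (hF : IsReductionBound fl s F) : 0 ≤ F 1 := by
  have h := hF [!₂[0, 1]] !₂[0, 0] !₂[1, 0] (by simp)
    (fun h => by simpa using congrArg (fun v : Pt => v 0) h) (by simp [orient]) _
    (farthest_mem fl s !₂[0, 0] !₂[1, 0] (by simp))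
  simpa using h

theorem chain_nonneg (s : Scheme) (n : ℕ) : 0 ≤ chain s n := by
  cases s <;> simp only [chain] <;> positivity

theorem one_le_chain (s : Scheme) {n : ℕ} (hn : 2 ≤ n) : 1 ≤ chain s n := by
  cases s with
  | simple =>
    simp only [chain]
    exact_mod_cast (by omega : 1 ≤ n - 1)
  | blocked m =>
    simp only [chain]
    have : (1 : ℝ) ≤ m := by exact_mod_cast m.pos
    have : (0 : ℝ) ≤ (n : ℝ) / m := by positivity
    linarith
  | pairwise =>
    simp only [chain]
    exact_mod_cast Nat.clog_pos one_lt_two hn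

/-! ### Termination and depth -/

/-- The factors on the two sides are negatives of each other, so symmetric rounding makes the
computed products equal. Thus `r` drops out of both sublists and the recursion terminates; for `r r
q` a factor `fl 0` suffices. -/
theorem not_rtHat_right {fl : ℝ → ℝ} (hsymm : ∀ x : ℝ, fl (-x) = -fl x) (p q : Pt) :
    ¬ rtHat fl p q q := by
  have h0 : fl (p 0 - q 0) = -fl (q 0 - p 0) := by rw [← hsymm, neg_sub]
  have h1 : fl (q 1 - p 1) = -fl (p 1 - q 1) := by rw [← hsymm, neg_sub]
  rw [rtHat, h0, h1, neg_mul_neg, mul_comm]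
  exact lt_irrefl _

theorem length_leftOf_lt {fl : ℝ → ℝ} {p q r : Pt} {L : List Pt} (hr : r ∈ L)
    (h : ¬ rtHat fl p r q) : (leftOf fl p q L).length < L.length := by
  rw [leftOf, List.length_filter_lt_length_iff_exists]
  exact ⟨r, hr, by simpa using h⟩

theorem exists_hullRun {fl : ℝ → ℝ} {ε : ℝ} (h : IsRounding fl ε)
    (hsymm : ∀ x : ℝ, fl (-x) = -fl x) (s : Scheme) (L : List Pt) (p r q : Pt)
    (hr : L ≠ [] → r ∈ L) : ∃ H D, HullRun fl s L p r q H D := by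
  induction hn : L.length using Nat.strong_induction_on generalizing L p r q with | _ n ih
  rcases le_or_gt L.length 1 with hL | hL
  · exact ⟨L, 0, .base L p r q hL⟩
  · have hr := hr (List.length_pos_iff.1 (by omega))
    obtain ⟨H₁, D₁, h₁⟩ := ih _ (hn ▸ length_leftOf_lt hr (not_rtHat_right hsymm p r))
      (leftOf fl p r L) p _ r (farthest_mem fl s p r) rfl
    obtain ⟨H₂, D₂, h₂⟩ := ih _ (hn ▸ length_leftOf_lt hr (not_rtHat_left h r q))
      (leftOf fl r q L) r _ q (farthest_mem fl s r q) rfl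
    exact ⟨_, _, .step L p r q H₁ H₂ D₁ D₂ hL h₁ h₂⟩

theorem HullRun.depth_le {fl : ℝ → ℝ} {ε : ℝ} (h : IsRounding fl ε)
    (hsymm : ∀ x : ℝ, fl (-x) = -fl x) {s : Scheme} {L H : List Pt} {p r q : Pt} {D : ℕ}
    (hrun : HullRun fl s L p r q H D) (hr : L ≠ [] → r ∈ L) : D ≤ L.length - 1 := by
  induction hrun with
  | base L p r q hL => exact Nat.zero_le _
  | step L p r q H₁ H₂ D₁ D₂ hL h₁ h₂ ih₁ ih₂ =>
    have hr := hr (List.length_pos_iff.1 (by omega))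
    have ih₁ := ih₁ (farthest_mem fl s p r)
    have ih₂ := ih₂ (farthest_mem fl s r q)
    have l₁ := length_leftOf_lt hr (not_rtHat_right hsymm p r)
    have l₂ := length_leftOf_lt hr (not_rtHat_left h r q)
    omega

theorem exists_isExtremePair {P : List Pt} (hP : P ≠ []) : ∃ p q, IsExtremePair P p q := by
  have hne : P.toFinset.Nonempty := by simpa [List.toFinset_nonempty_iff] using hP
  -- Lexicographic extremes satisfy the tie rule for vertical point sets.
  obtain ⟨p, hp, hpmin⟩ := P.toFinset.exists_min_image (fun u : Pt => toLex (u 0, u 1)) hne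
  obtain ⟨q, hq, hqmax⟩ := P.toFinset.exists_max_image (fun u : Pt => toLex (u 0, u 1)) hne
  simp only [List.mem_toFinset, Prod.Lex.toLex_le_toLex] at hp hpmin hq hqmax
  have hx : ∀ u ∈ P, p 0 ≤ u 0 ∧ u 0 ≤ q 0 := fun u hu =>
    ⟨(hpmin u hu).elim le_of_lt fun h => h.1.le, (hqmax u hu).elim le_of_lt fun h => h.1.le⟩
  refine ⟨p, q, hp, hq, hx, fun heq u hu => ⟨?_, ?_⟩⟩
  · refine (hpmin u hu).elim (fun h => absurd (hx u hu).2 ?_) fun h => h.2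
    exact not_le.2 (heq ▸ h)
  · refine (hqmax u hu).elim (fun h => absurd (hx u hu).1 ?_) fun h => h.2
    exact not_le.2 (heq ▸ h)

theorem exists_quickhullRun {fl : ℝ → ℝ} {ε : ℝ} (h : IsRounding fl ε)
    (hsymm : ∀ x : ℝ, fl (-x) = -fl x) (s : Scheme) {P : List Pt} (hP : P ≠ []) :
    ∃ H D, QuickhullRun fl s P H D := by
  obtain ⟨p, q, hpq⟩ := exists_isExtremePair hP
  obtain ⟨H₁, D₁, h₁⟩ := exists_hullRun h hsymm s (leftOf fl p q P) p _ q (farthest_mem fl s p q)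
  obtain ⟨H₂, D₂, h₂⟩ := exists_hullRun h hsymm s (leftOf fl q p P) q _ p (farthest_mem fl s q p)
  exact ⟨_, _, p, q, H₁, H₂, D₁, D₂, hpq, h₁, h₂, rfl, rfl⟩

theorem QuickhullRun.depth_le {fl : ℝ → ℝ} {ε : ℝ} (h : IsRounding fl ε)
    (hsymm : ∀ x : ℝ, fl (-x) = -fl x) {s : Scheme} {P H : List Pt} {D : ℕ}
    (hrun : QuickhullRun fl s P H D) : D ≤ P.length := by
  obtain ⟨p, q, H₁, H₂, D₁, D₂, ⟨hp, hq, -⟩, h₁, h₂, -, rfl⟩ := hrun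
  have d₁ := h₁.depth_le h hsymm (farthest_mem fl s p q)
  have d₂ := h₂.depth_le h hsymm (farthest_mem fl s q p)
  have l₁ := length_leftOf_lt (q := q) hp (not_rtHat_left h p q)
  have l₂ := length_leftOf_lt (q := p) hq (not_rtHat_left h q p)
  omega

theorem gamma6_le {ε : ℝ} (hε : 0 ≤ ε) (hε' : 12 * ε ≤ 1) : gamma6 ε ≤ 12 * ε := by
  rw [gamma6, div_le_iff₀ (by linarith)]
  nlinarith

end FloatQuickhull

open FloatQuickhull in
theorem mainTheorem1 :
    (∀ (ε : ℝ) (fl : ℝ → ℝ) (s : Scheme), 0 ≤ ε → 6 * ε < 1 → IsRounding fl ε →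
      -- a valid bound for the farthest-point reduction
      IsReductionBound fl s (fun n => 2 * gamma6 ε * chain s n) ∧
      -- Quickhull, for every bound `F` of the reduction that is not below `γ₆`
      (∀ F : ℕ → ℝ, IsReductionBound fl s F →
        ∀ (P H : List Pt) (D : ℕ), (2 ≤ P.length → gamma6 ε ≤ F P.length) →
          QuickhullRun fl s P H D → forwardError H P ≤ 2 * D * F P.length) ∧
      -- Quickhull, with the error `γ₆` per comparison
      (∀ (P H : List Pt) (D : ℕ), QuickhullRun fl s P H D →
        forwardError H P ≤ 2 * D * (gamma6 ε * chain s P.length)) ∧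
      -- the recursive function HULL, called for the points on one side of an extreme pair
      (∀ (L : List Pt) (p q : Pt) (H : List Pt) (D : ℕ),
        ((∀ u ∈ L, p 0 ≤ u 0 ∧ u 0 ≤ q 0) ∨ (∀ u ∈ L, q 0 ≤ u 0 ∧ u 0 ≤ p 0)) →
        (∀ u ∈ L, rtHat fl p u q) →
        HullRun fl s L p (farthest fl s p q L) q H D →
          forwardError (p :: q :: H) (p :: q :: L) ≤ 2 * D * (gamma6 ε * chain s L.length) ∧
          ∀ F : ℕ → ℝ, IsReductionBound fl s F → (2 ≤ L.length → gamma6 ε ≤ F L.length) →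
            forwardError (p :: q :: H) (p :: q :: L) ≤ 2 * D * F L.length) ∧
      -- termination and depth, for rounding that is symmetric about zero
      ((∀ x : ℝ, fl (-x) = -fl x) → ∀ P : List Pt, P ≠ [] →
        (∃ (H : List Pt) (D : ℕ), QuickhullRun fl s P H D) ∧
        ∀ (H : List Pt) (D : ℕ), QuickhullRun fl s P H D → D ≤ P.length)) ∧
    -- the resulting rates, with an absolute constant
    (∃ C : ℝ, 0 < C ∧ ∀ (ε : ℝ) (fl : ℝ → ℝ), 0 ≤ ε → 12 * ε ≤ 1 → IsRounding fl ε →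
      (∀ (P H : List Pt) (D : ℕ), QuickhullRun fl .simple P H D →
        forwardError H P ≤ C * (D * P.length * ε) ∧
        ((∀ x : ℝ, fl (-x) = -fl x) → forwardError H P ≤ C * ((P.length : ℝ) ^ 2 * ε))) ∧
      (∀ (m : ℕ+) (P H : List Pt) (D : ℕ), QuickhullRun fl (.blocked m) P H D →
        forwardError H P ≤ C * (D * ((m : ℝ) + P.length / (m : ℝ)) * ε)) ∧
      (∀ (P H : List Pt) (D : ℕ), QuickhullRun fl .pairwise P H D →
        forwardError H P ≤ C * (D * Real.log P.length * ε))) := by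
  -- The constant `48 = 2 * 24` is dictated by pairwise reduction; the other two orders would allow
  -- `24`.
  refine ⟨fun ε fl s hε hε' h => ⟨isReductionBound_gamma6 h hε hε' s, ?_, ?_, ?_, ?_⟩,
    48, by norm_num, fun ε fl hε hε₁ h => ?_⟩
  · intro F hF P H D hx hrun
    exact hrun.forwardError_le h hε hε' (fun h1 => h1 ▸ hF.nonneg) hx
  · intro P H D hrun
    have hγ := gamma6_nonneg hε hε'
    exact hrun.forwardError_le h hε hε' (fun _ => mul_nonneg hγ (chain_nonneg s _))
      fun hlen => le_mul_of_one_le_right hγ (one_le_chain s hlen)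
  · intro L p q H D hstrip hL hrun
    have hγ := gamma6_nonneg hε hε'
    exact ⟨hrun.forwardError_le h hε hε' hstrip hL fun hlen =>
        le_mul_of_one_le_right hγ (one_le_chain s hlen),
      fun F _ hx => hrun.forwardError_le h hε hε' hstrip hL hx⟩
  · intro hsymm P hP
    exact ⟨exists_quickhullRun h hsymm s hP, fun H D hrun => hrun.depth_le h hsymm⟩
  · have hε' : 6 * ε < 1 := by linarith
    have hγ := gamma6_le hε hε₁
    have hsimple : ∀ (P H : List Pt) (D : ℕ), QuickhullRun fl .simple P H D →
        forwardError H P ≤ 48 * (D * P.length * ε) := by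
      intro P H D hrun
      have hbound := hrun.forwardError_le h hε hε' (x := 12 * ε * P.length)
        (fun _ => by positivity) (fun hlen => by
          have : (2 : ℝ) ≤ P.length := by exact_mod_cast hlen
          nlinarith)
      have : 0 ≤ D * P.length * ε := by positivity
      linarith
    refine ⟨fun P H D hrun => ⟨hsimple P H D hrun, fun hsymm => ?_⟩, fun m P H D hrun => ?_,
      fun P H D hrun => ?_⟩
    · have hD : (D : ℝ) ≤ P.length := by exact_mod_cast hrun.depth_le h hsymm
      refine (hsimple P H D hrun).trans ?_
      rw [sq]
      gcongr
    · have hm : (1 : ℝ) ≤ m := by exact_mod_cast m.pos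
      have hn : 0 ≤ (P.length : ℝ) / m := by positivity
      have hbound := hrun.forwardError_le h hε hε' (x := 12 * ε * (m + P.length / m))
        (fun _ => by positivity) (fun _ => by nlinarith)
      have : 0 ≤ D * ((m : ℝ) + P.length / m) * ε := by positivity
      linarith
    -- Since `log 2 > 1/2`, doubling `12ε` makes `x ≥ γ₆` from two points on; for one point `x = 0`.
    · have hbound := hrun.forwardError_le h hε hε' (x := 24 * ε * Real.log P.length)
        (fun h1 => by simp [h1]) (fun hlen => by
          have h2 : (2 : ℝ) ≤ P.length := by exact_mod_cast hlen
          have h3 := Real.log_le_log zero_lt_two h2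
          nlinarith [Real.log_two_gt_d9])
      linarith
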